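/- Let $n,e,t$ be positive integers and $q=(2e+1)t$. Equip $\mathbb{Z}_q=\{0,1,\dots,q-1\}$ with the circular distance $d(x,y)=\min\{|x-y|,\,q-|x-y|\}$ and $\mathbb{Z}_q^n$ with the maximum metric $d(x,y)=\max_{1\le i\le n} d(x_i,y_i)$. A linear perfect $(n,e,q)$-code is a subgroup $C\subseteq\mathbb{Z}_q^n$ such that every element of $\mathbb{Z}_q^n$ belongs to exactly one ball $B(c,e)$ with $c\in C$. Two such codes $C_1,C_2$ are isomorphic if $C_1=f(C_2)$ for some group automorphism $f$ of $\mathbb{Z}_q^n$. For a prime $p$ let $\nu_p(m)$ be the exponent of $p$ in the factorization of $m$, let $[x^k]f(x)$ denote the coefficient of $x^k$ in the power series $f(x)$, and suppose that $(2e+1)^{n-1}\mid t$. Then the number $N$ of isomorphism classes of linear perfect $(n,e,q)$-codes is $$N=\prod_{p\mid 2e+1}\,[x^{n\nu_p(2e+1)}]\;\frac{1}{(1-x)(1-x^2)\cdots(1-x^n)},$$ where $p$ runs over the prime divisors of $2e+1$. In particular, for $n=2$, $$N=\prod_{p\mid 2e+1}[x^{2\nu_p(2e+1)}]\frac{1}{(1-x)(1-x^2)}=\prod_{p\mid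 2e+1}\bigl(\nu_p(2e+1)+1\bigr)=\sigma_0(2e+1),$$ the number of divisors of $2e+1$. For $n=3$, $$N=\prod_{p\mid 2e+1}[x^{3\nu_p(2e+1)}]\frac{1}{(1-x)(1-x^2)(1-x^3)}=\prod_{p\mid 2e+1}\Bigl\lceil \tfrac34\bigl(\nu_p(2e+1)+1\bigr)^2\Bigr\rfloor,$$ where $\lceil x\rfloor$ denotes the integer nearest to $x$; in particular, if $n=3$ and $2e+1$ is square-free, then $N=3^{\omega(2e+1)}$, where $\omega(m)$ is the number of distinct prime divisors of $m$. -/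

import Mathlib

namespace MaxMetricCode

/-- Distance between `x` and `y` in the circular graph on `ℤ_q = {0, …, q - 1}`:
`min {|x - y|, q - |x - y|}`, computed with the representatives in `{0, …, q - 1}`. -/
def circDist {q : ℕ} (x y : ZMod q) : ℕ :=
  min ((x.val : ℤ) - (y.val : ℤ)).natAbs (q - ((x.val : ℤ) - (y.val : ℤ)).natAbs)

/-- The maximum (Chebyshev) metric on `ℤ_q^n`. -/
def maxDist {n q : ℕ} (x y : Fin n → ZMod q) : ℕ :=
  Finset.univ.sup fun i => circDist (x i) (y i)

/-- The ball `B(c, r)` of the maximum metric. -/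
def ball {n q : ℕ} (c : Fin n → ZMod q) (r : ℕ) : Set (Fin n → ZMod q) :=
  {x | maxDist x c ≤ r}

/-- A code `C ⊆ ℤ_q^n` is `e`-perfect if every word lies in exactly one ball of radius `e`
centred at a codeword. -/
def IsPerfect {n q : ℕ} (e : ℕ) (C : Set (Fin n → ZMod q)) : Prop :=
  ∀ x : Fin n → ZMod q, ∃! c : Fin n → ZMod q, c ∈ C ∧ x ∈ ball c e

/-- The set of linear perfect `(n, e, q)`-codes in the maximum metric (a linear code is a subgroup
of `ℤ_q^n`). -/
def LPL (n e q : ℕ) : Type :=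
  {C : AddSubgroup (Fin n → ZMod q) // IsPerfect e (C : Set (Fin n → ZMod q))}

/-- Algebraic equivalence (isomorphism) of linear perfect codes: `C₁ = f(C₂)` for some group
automorphism `f` of `ℤ_q^n`. -/
instance isoSetoid (n e q : ℕ) : Setoid (LPL n e q) where
  r C₁ C₂ := ∃ f : (Fin n → ZMod q) ≃+ (Fin n → ZMod q), C₁.1 = C₂.1.map f.toAddMonoidHom
  iseqv :=
    { refl := fun C => ⟨AddEquiv.refl _, by ext x; simp⟩
      symm := by
        rintro C₁ C₂ ⟨f, hf⟩
        exact ⟨f.symm, by rw [hf]; ext x; simp⟩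
      trans := by
        rintro C₁ C₂ C₃ ⟨f, hf⟩ ⟨g, hg⟩
        exact ⟨g.trans f, by rw [hf, hg, AddSubgroup.map_map]; rfl⟩ }

/-- The number of isomorphism classes of linear perfect `(n, e, q)`-codes. -/
noncomputable def numIsoClasses (n e q : ℕ) : ℕ :=
  Nat.card (Quotient (isoSetoid n e q))

/-- The power series `1 / ((1 - x)(1 - x²) ⋯ (1 - xⁿ))`. -/
noncomputable def genFun (n : ℕ) : PowerSeries ℚ :=
  (∏ i ∈ Finset.Icc 1 n, (1 - (PowerSeries.X : PowerSeries ℚ) ^ i))⁻¹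

end MaxMetricCode

/-! A ball of radius `e` is a translate of the box {-e,…,e}^n reduced mod q, so C is perfect exactly
when this box is a transversal of C. The quotient ℤ_q^n / C is then an abelian group of order
(2e+1)^n with n generators.

The quotient determines the class (`exists_map_eq_iff_nonempty_quotient_addEquiv`): pull C back to a
lattice in ℤ^n and put it in Smith form. Two lattices with the same invariant factors differ by a
unimodular map, which descends mod q. Classes thus embed into divisor chains d_1 ∣ … ∣ d_n with
product (2e+1)^n.

Every chain occurs. By induction the group is a sum of n progressions {-e•g,…,e•g}
(`exists_box_injective`): split off an element of order 2e+1 whose quotient needs one generator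
fewer. Since (2e+1)^n ∣ q kills the group, the g's define a map from ℤ_q^n, and its kernel is the
code.

Prime by prime, a chain is a partition of n·ν_p(2e+1) into at most n parts, counted by the
generating function. -/

/-! ### Smith normal form over ℤ with a divisibility chain. -/

/-- The elementary unimodular transformation turning `diag (g * α, g * β)` with
`u * α + v * β = 1` into `diag (g, g * α * β)` on the coordinates `i` and `j`. -/
def gcdLcmEquiv {n : ℕ} {i j : Fin n} (hij : i ≠ j) {α β u v : ℤ} (h : u * α + v * β = 1) :
    (Fin n → ℤ) ≃ₗ[ℤ] (Fin n → ℤ) where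
  toFun x := Function.update (Function.update x i (x i + x j)) j (-(v * β) * x i + u * α * x j)
  invFun x := Function.update (Function.update x i (u * α * x i - x j)) j (v * β * x i + x j)
  map_add' x y := by
    ext k
    by_cases hj : k = j
    · subst hj; simp; ring
    · by_cases hi : k = i
      · subst hi; simp [hj]; ring
      · simp [hi, hj]
  map_smul' c x := by
    ext k
    by_cases hj : k = j
    · subst hj; simp; ring
    · by_cases hi : k = i
      · subst hi; simp [hj]; ring
      · simp [hi, hj]
  left_inv x := by
    ext k
    by_cases hj : k = j
    · subst hj; simp [hij]; linear_combination x k * h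
    · by_cases hi : k = i
      · subst hi; simp [hj]; linear_combination x k * h
      · simp [hi, hj]
  right_inv x := by
    ext k
    by_cases hj : k = j
    · subst hj; simp [hij]; linear_combination x k * h
    · by_cases hi : k = i
      · subst hi; simp [hj]; linear_combination x k * h
      · simp [hi, hj]

theorem exists_equiv_diag_gcd_lcm {n : ℕ} {i j : Fin n} (hij : i ≠ j) (a : Fin n → ℕ)
    (ha : ∀ k, a k ≠ 0) :
    ∃ T : (Fin n → ℤ) ≃ₗ[ℤ] (Fin n → ℤ), ∀ x : Fin n → ℤ, (∀ k, (a k : ℤ) ∣ x k) ↔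
      ∀ k, ((Function.update (Function.update a i (Nat.gcd (a i) (a j))) j
        (Nat.lcm (a i) (a j)) k : ℕ) : ℤ) ∣ T x k := by
  obtain ⟨α, hα⟩ := Nat.gcd_dvd_left (a i) (a j)
  obtain ⟨β, hβ⟩ := Nat.gcd_dvd_right (a i) (a j)
  set g := Nat.gcd (a i) (a j) with hg
  have hg0 : g ≠ 0 := fun h => ha i (by rw [hα, h, zero_mul])
  have hl : Nat.lcm (a i) (a j) = g * α * β := by
    apply Nat.eq_of_mul_eq_mul_left (Nat.pos_of_ne_zero hg0)
    rw [hg, Nat.gcd_mul_lcm, ← hg]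
    conv_lhs => rw [hα, hβ]
    ring
  have hbez : (Nat.gcdA (a i) (a j)) * (α : ℤ) + Nat.gcdB (a i) (a j) * (β : ℤ) = 1 := by
    have h := Nat.gcd_eq_gcd_ab (a i) (a j)
    rw [← hg] at h
    have hαz : (a i : ℤ) = g * α := by exact_mod_cast hα
    have hβz : (a j : ℤ) = g * β := by exact_mod_cast hβ
    have hgz : (g : ℤ) ≠ 0 := by exact_mod_cast hg0
    apply mul_left_cancel₀ hgz
    linear_combination -h - Nat.gcdA (a i) (a j) * hαz - Nat.gcdB (a i) (a j) * hβz
  rw [hl]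
  set u := Nat.gcdA (a i) (a j)
  set v := Nat.gcdB (a i) (a j)
  refine ⟨gcdLcmEquiv hij hbez, fun x => ⟨fun hx k => ?_, fun hx k => ?_⟩⟩
  · obtain ⟨s, hs⟩ := hx i
    obtain ⟨r, hr⟩ := hx j
    rw [hα] at hs
    rw [hβ] at hr
    push_cast at hs hr
    by_cases hj : k = j
    · subst hj
      simp only [gcdLcmEquiv, LinearEquiv.coe_mk, LinearMap.coe_mk, AddHom.coe_mk,
        Function.update_self]
      rw [hs, hr]
      exact ⟨-v * s + u * r, by push_cast; ring⟩
    · by_cases hi : k = i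
      · subst hi
        simp only [gcdLcmEquiv, LinearEquiv.coe_mk, LinearMap.coe_mk, AddHom.coe_mk,
          Function.update_self, Function.update_of_ne hj]
        rw [hs, hr]
        exact ⟨α * s + β * r, by ring⟩
      · simpa [gcdLcmEquiv, hi, hj] using hx k
  · have hyi := hx i
    have hyj := hx j
    simp only [Function.update_self, Function.update_of_ne hij] at hyi hyj
    obtain ⟨y, rfl⟩ := (gcdLcmEquiv hij hbez).symm.surjective x
    rw [LinearEquiv.apply_symm_apply] at hx hyi hyj
    obtain ⟨s, hs⟩ := hyi
    obtain ⟨r, hr⟩ := hyj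
    push_cast at hr
    by_cases hj : k = j
    · subst hj
      simp only [gcdLcmEquiv, LinearEquiv.coe_symm_mk', Function.update_self]
      rw [hs, hr, hβ]
      exact ⟨v * s + α * r, by push_cast; ring⟩
    · by_cases hi : k = i
      · subst hi
        simp only [gcdLcmEquiv, LinearEquiv.coe_symm_mk', Function.update_self,
          Function.update_of_ne hj]
        rw [hs, hr, hα]
        exact ⟨u * s - β * r, by push_cast; ring⟩
      · simpa [gcdLcmEquiv, hi, hj] using hx k

/-- Smith normal form over `ℤ` with the divisibility chain, for submodules of full rank. -/
theorem exists_smith_chain {n : ℕ} (L : Submodule ℤ (Fin n → ℤ)) {N : ℕ} (hN : N ≠ 0)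
    (hL : ∀ x : Fin n → ℤ, (N : ℤ) • x ∈ L) :
    ∃ (A : (Fin n → ℤ) ≃ₗ[ℤ] (Fin n → ℤ)) (d : Fin n → ℕ),
      (∀ i j, i ≤ j → d i ∣ d j) ∧ (∀ i, d i ∣ N) ∧
      ∀ x, x ∈ L ↔ ∀ i, (d i : ℤ) ∣ A x i := by
  have hrank : Module.finrank ℤ L = Module.finrank ℤ (Fin n → ℤ) := by
    refine le_antisymm (Submodule.finrank_le L) ?_
    refine ((LinearMap.lsmul ℤ (Fin n → ℤ) (N : ℤ)).codRestrict L hL).finrank_le_finrank_of_injective ?_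
    refine (LinearMap.lsmul_injective ?_).codRestrict _
    exact_mod_cast hN
  let P : (Fin n → ℕ) → Prop := fun a => ∃ A : (Fin n → ℤ) ≃ₗ[ℤ] (Fin n → ℤ),
    ∀ x, x ∈ L ↔ ∀ i, (a i : ℤ) ∣ A x i
  have hPN : ∀ a, P a → ∀ i, a i ∣ N := by
    rintro a ⟨A, hA⟩ i
    have := (hA _).1 (hL (A.symm (Pi.single i 1))) i
    rw [map_smul, LinearEquiv.apply_symm_apply, Pi.smul_apply, Pi.single_eq_same, smul_eq_mul,
      mul_one] at this
    exact_mod_cast this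
  have hne : ∃ a, P a := by
    let b := Pi.basisFun ℤ (Fin n)
    let b' := Submodule.smithNormalFormTopBasis b hrank
    let ab := Submodule.smithNormalFormBotBasis b hrank
    have ab_eq := Submodule.smithNormalFormBotBasis_def b hrank
    refine ⟨fun i => (Submodule.smithNormalFormCoeffs b hrank i).natAbs, b'.equivFun, fun x => ?_⟩
    simp_rw [Int.natAbs_dvd, Module.Basis.equivFun_apply]
    rw [ab.mem_submodule_iff']
    simp_rw [ab, ab_eq]
    have : ∀ (c : Fin n → ℤ) (i), b'.repr (∑ j, c j •
        Submodule.smithNormalFormCoeffs b hrank j • b' j) i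
          = Submodule.smithNormalFormCoeffs b hrank i * c i := by
      intro c i
      simp only [← mul_smul, b'.repr_sum_self, mul_comm]
    constructor
    · rintro ⟨c, rfl⟩ i
      exact ⟨c i, this c i⟩
    · rintro ha
      choose c hc using ha
      exact ⟨c, b'.ext_elem fun i => Eq.trans (hc i) (this c i).symm⟩
  have hfin : {a | P a}.Finite := by
    refine (Set.finite_Iic (fun _ : Fin n => N)).subset fun a ha i => ?_
    exact Nat.le_of_dvd (Nat.pos_of_ne_zero hN) (hPN a ha i)
  -- Among all diagonal forms, finitely many as their entries divide `N`, take one maximizing ∑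
  -- k·d_k. If d_i ∤ d_j with i < j, replacing the pair by (gcd, lcm) would increase this weight.
  obtain ⟨d, hd, hmax⟩ := hfin.exists_maximalFor (fun a => ∑ i : Fin n, (i : ℕ) * a i) _ hne
  obtain ⟨A, hA⟩ := hd
  refine ⟨A, d, fun i j hij => ?_, hPN d ⟨A, hA⟩, hA⟩
  rcases hij.eq_or_lt with rfl | hlt
  · exact dvd_rfl
  have hd0 : ∀ k, d k ≠ 0 := fun k hk => hN (by simpa [hk] using hPN d ⟨A, hA⟩ k)
  obtain ⟨T, hT⟩ := exists_equiv_diag_gcd_lcm hlt.ne d hd0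
  set d' := Function.update (Function.update d i (Nat.gcd (d i) (d j))) j (Nat.lcm (d i) (d j))
    with hd'
  have hPd' : P d' := ⟨A.trans T, fun x => by rw [hA, hT]; rfl⟩
  by_contra hndvd
  have hglt : Nat.gcd (d i) (d j) < d i := by
    refine lt_of_le_of_ne (Nat.gcd_le_left _ (Nat.pos_of_ne_zero (hd0 i))) fun h => hndvd ?_
    exact Nat.gcd_eq_left_iff_dvd.mp h
  have hsum : ∑ k : Fin n, (k : ℕ) * d k < ∑ k : Fin n, (k : ℕ) * d' k := by
    have hsplit : ∀ a : Fin n → ℕ, ∑ k : Fin n, (k : ℕ) * a k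
        = (j : ℕ) * a j + ((i : ℕ) * a i + ∑ k ∈ (Finset.univ.erase j).erase i, (k : ℕ) * a k) := by
      intro a
      rw [Finset.add_sum_erase _ (fun k : Fin n => (k : ℕ) * a k) (by simp [hlt.ne]),
        Finset.add_sum_erase _ (fun k : Fin n => (k : ℕ) * a k) (by simp)]
    rw [hsplit d, hsplit d']
    have hrest : ∑ k ∈ (Finset.univ.erase j).erase i, (k : ℕ) * d' k
        = ∑ k ∈ (Finset.univ.erase j).erase i, (k : ℕ) * d k := by
      refine Finset.sum_congr rfl fun k hk => ?_
      simp only [Finset.mem_erase, Finset.mem_univ, and_true] at hk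
      simp [hd', hk.1, hk.2]
    have e1 : d' j = Nat.lcm (d i) (d j) := by simp [hd']
    have e2 : d' i = Nat.gcd (d i) (d j) := by simp [hd', hlt.ne]
    rw [hrest, e1, e2]
    have hmul := Nat.gcd_mul_lcm (d i) (d j)
    obtain ⟨β, hβ⟩ := Nat.gcd_dvd_right (d i) (d j)
    obtain ⟨α, hα⟩ := Nat.gcd_dvd_left (d i) (d j)
    set g := Nat.gcd (d i) (d j)
    have hjl : d j ≤ Nat.lcm (d i) (d j) :=
      Nat.le_of_dvd (Nat.lcm_pos (Nat.pos_of_ne_zero (hd0 i)) (Nat.pos_of_ne_zero (hd0 j)))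
        (Nat.dvd_lcm_right _ _)
    have hgj : g ≤ d j := Nat.gcd_le_right _ (Nat.pos_of_ne_zero (hd0 j))
    have hij' : (i : ℕ) < j := hlt
    -- Multiplied by g and using g·lcm = d_i·d_j, this is (d_i - g)(d_j - g) ≥ 0.
    have key : d i + d j ≤ g + Nat.lcm (d i) (d j) := by
      by_contra hcon
      push Not at hcon
      have hg0 : 0 < g := Nat.gcd_pos_of_pos_left _ (Nat.pos_of_ne_zero (hd0 i))
      obtain ⟨x, hx⟩ := Nat.exists_eq_add_of_le hglt.le
      obtain ⟨y, hy⟩ := Nat.exists_eq_add_of_le hgj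
      have h1 := Nat.mul_lt_mul_of_pos_left hcon hg0
      rw [mul_add, hmul, hx, hy] at h1
      nlinarith [Nat.zero_le (x * y)]
    nlinarith
  exact absurd (hmax hPd' hsum.le) (not_le.mpr hsum)

/-! ### Invariant factors of finite abelian groups. -/

theorem card_zmod_nsmul_eq_zero {d : ℕ} (hd : d ≠ 0) (k : ℕ) :
    Nat.card {x : ZMod d // k • x = 0} = Nat.gcd d k := by
  have : NeZero d := ⟨hd⟩
  have h := IsAddCyclic.card_nsmulAddMonoidHom_ker (G := ZMod d) k
  rw [Nat.card_zmod] at h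
  rw [← h]
  exact Nat.card_congr (Equiv.subtypeEquivRight fun x => by simp [AddMonoidHom.mem_ker])

/-- Torsion counts are isomorphism invariants. For k = p^j the p-adic valuation of the product is ∑
min(ν_p(d_i), j), which is the input of `eq_of_sum_min_eq`. -/
theorem card_pi_zmod_nsmul_eq_zero {n : ℕ} {d : Fin n → ℕ} (hd : ∀ i, d i ≠ 0) (k : ℕ) :
    Nat.card {x : ∀ i, ZMod (d i) // k • x = 0} = ∏ i, Nat.gcd (d i) k := by
  have e : {x : ∀ i, ZMod (d i) // k • x = 0} ≃ ∀ i, {x : ZMod (d i) // k • x = 0} :=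
    (Equiv.subtypeEquivRight fun x => by simp [funext_iff]).trans Equiv.subtypePiEquivPi
  rw [Nat.card_congr e, Nat.card_pi]
  exact Finset.prod_congr rfl fun i _ => card_zmod_nsmul_eq_zero (hd i) k

/-- A monotone tuple of naturals is determined by the sums of its truncations. -/
theorem eq_of_sum_min_eq {n : ℕ} {l l' : Fin n → ℕ} (hl : Monotone l) (hl' : Monotone l')
    (h : ∀ j, ∑ i, min (l i) j = ∑ i, min (l' i) j) : l = l' := by
  -- Successive differences of the truncated sums count the entries exceeding j.
  have hstep : ∀ (a : Fin n → ℕ) (j : ℕ), ∑ i, min (a i) (j + 1)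
      = ∑ i, min (a i) j + (Finset.univ.filter fun i => j < a i).card := by
    intro a j
    rw [Finset.card_filter, ← Finset.sum_add_distrib]
    refine Finset.sum_congr rfl fun i _ => ?_
    split_ifs <;> omega
  have hcard : ∀ j, (Finset.univ.filter fun i => j < l i).card
      = (Finset.univ.filter fun i => j < l' i).card := by
    intro j
    have h1 := h (j + 1)
    rw [hstep l, hstep l', h j] at h1
    omega
  have hset : ∀ j, (Finset.univ.filter fun i => j < l i) = Finset.univ.filter fun i => j < l' i := by
    -- By monotonicity both sets are upper sets of `Fin n`, hence nested, so equal cardinality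
    -- forces equality.
    intro j
    by_cases hsub : (Finset.univ.filter fun i => j < l i) ⊆ Finset.univ.filter fun i => j < l' i
    · exact Finset.eq_of_subset_of_card_le hsub (hcard j).ge
    · refine (Finset.eq_of_subset_of_card_le (fun i hi => ?_) (hcard j).le).symm
      obtain ⟨k, hk, hk'⟩ := Finset.not_subset.mp hsub
      simp only [Finset.mem_filter, Finset.mem_univ, true_and, not_lt] at hk hk' hi ⊢
      rcases le_total k i with hki | hik
      · exact hk.trans_le (hl hki)
      · exact absurd hi (not_lt.mpr ((hl' hik).trans hk'))
  funext i
  refine le_antisymm ?_ ?_ <;> by_contra! hlt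
  · have : i ∈ Finset.univ.filter fun k => l' i < l k := by simpa using hlt
    rw [hset] at this
    simp at this
  · have : i ∈ Finset.univ.filter fun k => l i < l' k := by simpa using hlt
    rw [← hset] at this
    simp at this

theorem factorization_mono_of_chain {n : ℕ} {d : Fin n → ℕ} (hd : ∀ i, d i ≠ 0)
    (hc : ∀ i j, i ≤ j → d i ∣ d j) (p : ℕ) : Monotone fun i => (d i).factorization p :=
  fun i j hij => (Nat.factorization_le_iff_dvd (hd i) (hd j)).mpr (hc i j hij) p

/-- Uniqueness of the invariant factors of a finite abelian group. -/
theorem invariant_factors_unique {n : ℕ} {d d' : Fin n → ℕ} (hd : ∀ i, d i ≠ 0)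
    (hd' : ∀ i, d' i ≠ 0) (hc : ∀ i j, i ≤ j → d i ∣ d j) (hc' : ∀ i j, i ≤ j → d' i ∣ d' j)
    (e : (∀ i, ZMod (d i)) ≃+ ∀ i, ZMod (d' i)) : d = d' := by
  have hprod : ∀ k, ∏ i, Nat.gcd (d i) k = ∏ i, Nat.gcd (d' i) k := by
    intro k
    rw [← card_pi_zmod_nsmul_eq_zero hd, ← card_pi_zmod_nsmul_eq_zero hd']
    refine Nat.card_congr (e.toEquiv.subtypeEquiv fun x => ?_)
    change k • x = 0 ↔ k • e x = 0
    rw [← map_nsmul, map_eq_zero_iff e e.injective]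
  have hfac : ∀ (a : Fin n → ℕ), (∀ i, a i ≠ 0) → ∀ p, p.Prime → ∀ j,
      (∏ i, Nat.gcd (a i) (p ^ j)).factorization p = ∑ i, min ((a i).factorization p) j := by
    intro a ha p hp j
    rw [Nat.factorization_prod fun i _ => Nat.gcd_ne_zero_left (ha i), Finsupp.finsetSum_apply]
    refine Finset.sum_congr rfl fun i _ => ?_
    rw [Nat.factorization_gcd (ha i) (pow_ne_zero _ hp.ne_zero), Finsupp.inf_apply,
      hp.factorization_pow, Finsupp.single_eq_same]
  funext i
  refine Nat.eq_of_factorization_eq (hd i) (hd' i) fun p => ?_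
  by_cases hp : p.Prime
  · refine congrFun (eq_of_sum_min_eq (factorization_mono_of_chain hd hc p)
      (factorization_mono_of_chain hd' hc' p) fun j => ?_) i
    rw [← hfac d hd p hp, ← hfac d' hd' p hp, hprod]
  · simp [Nat.factorization_eq_zero_of_not_prime, hp]

/-- A quotient of `ℤⁿ` by a subgroup in Smith normal form is a product of cyclic groups. -/
theorem nonempty_addEquiv_pi_zmod {n : ℕ} {G : Type*} [AddCommGroup G] (φ : (Fin n → ℤ) →+ G)
    (hφ : Function.Surjective φ) (A : (Fin n → ℤ) ≃ₗ[ℤ] (Fin n → ℤ)) (d : Fin n → ℕ)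
    (hA : ∀ x, φ x = 0 ↔ ∀ i, (d i : ℤ) ∣ A x i) : Nonempty (G ≃+ ∀ i, ZMod (d i)) := by
  let π : (Fin n → ℤ) →+ ∀ i, ZMod (d i) :=
    (AddMonoidHom.pi fun i => (Int.castAddHom (ZMod (d i))).comp (Pi.evalAddMonoidHom _ i)).comp
      A.toAddEquiv.toAddMonoidHom
  have hπ : ∀ x i, π x i = (A x i : ZMod (d i)) := fun _ _ => rfl
  have hπs : Function.Surjective π := by
    intro y
    choose z hz using fun i => ZMod.intCast_surjective (y i)
    exact ⟨A.symm z, funext fun i => by rw [hπ, LinearEquiv.apply_symm_apply, hz]⟩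
  have hker : φ.ker = π.ker := by
    ext x
    rw [AddMonoidHom.mem_ker, AddMonoidHom.mem_ker, hA, funext_iff]
    simp only [hπ, Pi.zero_apply, ZMod.intCast_zmod_eq_zero_iff_dvd]
  exact ⟨(QuotientAddGroup.quotientKerEquivOfSurjective φ hφ).symm.trans
    ((QuotientAddGroup.quotientAddEquivOfEq hker).trans
      (QuotientAddGroup.quotientKerEquivOfSurjective π hπs))⟩

/-- Invariant factor decomposition of a finite abelian group generated by `n` elements. -/
theorem exists_invariant_factors {n : ℕ} {G : Type*} [AddCommGroup G] [Finite G]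
    (φ : (Fin n → ℤ) →+ G) (hφ : Function.Surjective φ) :
    ∃ d : Fin n → ℕ, (∀ i, d i ≠ 0) ∧ (∀ i j, i ≤ j → d i ∣ d j) ∧
      Nonempty (G ≃+ ∀ i, ZMod (d i)) := by
  have h0 : Nat.card G ≠ 0 := Nat.card_pos.ne'
  obtain ⟨A, d, hc, hdN, hA⟩ := exists_smith_chain (AddSubgroup.toIntSubmodule φ.ker) h0
    fun x => by
      change φ _ = 0
      rw [Nat.cast_smul_eq_nsmul, map_nsmul, card_nsmul_eq_zero']
  exact ⟨d, fun i hi => h0 (by simpa [hi] using hdN i), hc,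
    nonempty_addEquiv_pi_zmod φ hφ A d hA⟩

/-! ### Factorization of a group into arithmetic progressions. -/

/-- The last coordinate has order exactly m and the first has order d_0 ∣ m. Here `n ≠ 0` keeps the
two coordinates distinct. -/
theorem pi_zmod_nsmul_eq_zero_iff {n : ℕ} {d : Fin (n + 1) → ℕ} {m k : ℕ} (hn : n ≠ 0)
    (hd0 : d 0 ∣ m) (hdl : m ∣ d (Fin.last n)) (hl : d (Fin.last n) ≠ 0) :
    k • ((Pi.single 0 1 : ∀ i, ZMod (d i)) +
      (d (Fin.last n) / m) • (Pi.single (Fin.last n) 1 : ∀ i, ZMod (d i))) = 0 ↔ m ∣ k := by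
  have h0l : (0 : Fin (n + 1)) ≠ Fin.last n := fun h => hn (by simpa using congrArg Fin.val h.symm)
  obtain ⟨c, hc⟩ := hdl
  have hm : 0 < m := Nat.pos_of_ne_zero fun h => hl (by simp [hc, h])
  have hc0 : 0 < c := Nat.pos_of_ne_zero fun h => hl (by simp [hc, h])
  have hdiv : d (Fin.last n) / m = c := by rw [hc, Nat.mul_div_cancel_left _ hm]
  rw [hdiv, funext_iff]
  constructor
  · intro h
    have := h (Fin.last n)
    simp only [Pi.smul_apply, Pi.add_apply, Pi.single_eq_of_ne h0l.symm, Pi.single_eq_same,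
      zero_add, Pi.zero_apply] at this
    rw [nsmul_eq_mul, nsmul_eq_mul, mul_one, ← Nat.cast_mul, ZMod.natCast_eq_zero_iff, hc] at this
    exact Nat.dvd_of_mul_dvd_mul_right hc0 this
  · intro h i
    by_cases hi0 : i = 0
    · subst hi0
      simp only [Pi.smul_apply, Pi.add_apply, Pi.single_eq_of_ne h0l, Pi.single_eq_same,
        Pi.zero_apply, smul_zero, add_zero]
      rw [nsmul_eq_mul, mul_one, ZMod.natCast_eq_zero_iff]
      exact hd0.trans h
    · by_cases hil : i = Fin.last n
      · subst hil
        simp only [Pi.smul_apply, Pi.add_apply, Pi.single_eq_of_ne hi0, Pi.single_eq_same,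
          zero_add, Pi.zero_apply]
        rw [nsmul_eq_mul, nsmul_eq_mul, mul_one, ← Nat.cast_mul, ZMod.natCast_eq_zero_iff, hc]
        exact Nat.mul_dvd_mul_right h c
      · simp [Pi.single_eq_of_ne hi0, Pi.single_eq_of_ne hil]

/-- A finite abelian group of order `m ^ (n + 1)` generated by `n + 1` elements has an element
of order `m` such that the quotient is generated by `n` elements. -/
theorem exists_addOrderOf_eq_and_surjective {n m : ℕ} {d : Fin (n + 1) → ℕ} (hd : ∀ i, d i ≠ 0)
    (hc : ∀ i j, i ≤ j → d i ∣ d j) (hprod : ∏ i, d i = m ^ (n + 1)) :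
    ∃ g : ∀ i, ZMod (d i), (∀ k : ℕ, k • g = 0 ↔ m ∣ k) ∧
      ∃ ψ : (Fin n → ℤ) →+ (∀ i, ZMod (d i)) ⧸ AddSubgroup.zmultiples g,
        Function.Surjective ψ := by
  have hx : ∀ x : ∀ i, ZMod (d i), x = ∑ i, (x i).val • (Pi.single i 1 : ∀ i, ZMod (d i)) := by
    intro x
    ext j
    have : NeZero (d j) := ⟨hd j⟩
    rw [Finset.sum_apply, Finset.sum_eq_single j]
    · simp
    · intro i _ hij
      simp [Pi.single_eq_of_ne hij.symm]
    · simp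
  -- The chain gives d_0^(n+1) ∣ ∏ d_i = m^(n+1) ∣ d_n^(n+1); take roots.
  have hd0 : d 0 ∣ m := by
    rw [← Nat.pow_dvd_pow_iff n.succ_ne_zero, ← hprod]
    simpa using Finset.prod_dvd_prod_of_dvd (s := Finset.univ) (fun _ : Fin (n + 1) => d 0) d
      fun i _ => hc 0 i (Fin.zero_le i)
  have hdl : m ∣ d (Fin.last n) := by
    rw [← Nat.pow_dvd_pow_iff n.succ_ne_zero, ← hprod]
    simpa using Finset.prod_dvd_prod_of_dvd (s := Finset.univ) d
      (fun _ : Fin (n + 1) => d (Fin.last n)) fun i _ => hc i _ (Fin.le_last i)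
  rcases Nat.eq_zero_or_pos n with rfl | hn
  · have hdm : d 0 = m := by simpa using hprod
    refine ⟨Pi.single 0 1, fun k => ?_, 0, fun y => ?_⟩
    · rw [← Pi.single_smul, Pi.single_eq_zero_iff, nsmul_eq_mul, mul_one,
        ZMod.natCast_eq_zero_iff, hdm]
    · obtain ⟨x, rfl⟩ := QuotientAddGroup.mk_surjective y
      refine ⟨0, ?_⟩
      rw [AddMonoidHom.zero_apply, eq_comm, QuotientAddGroup.eq_zero_iff, hx x]
      rw [Fin.sum_univ_one]
      exact nsmul_mem (AddSubgroup.mem_zmultiples _) _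
  set c := d (Fin.last n) / m with hcdef
  let s : ∀ i, ∀ i, ZMod (d i) := fun i => Pi.single i 1
  refine ⟨s 0 + c • s (Fin.last n),
    fun k => pi_zmod_nsmul_eq_zero_iff hn.ne' hd0 hdl (hd _), ?_⟩
  set g := s 0 + c • s (Fin.last n)
  let θ : (Fin n → ℤ) →+ ∀ i, ZMod (d i) :=
    { toFun := fun z => ∑ i, z i • s i.succ
      map_zero' := by simp
      map_add' := fun a b => by simp [add_smul, Finset.sum_add_distrib] }
  refine ⟨(QuotientAddGroup.mk' (AddSubgroup.zmultiples g)).comp θ, ?_⟩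
  rw [← AddMonoidHom.range_eq_top, eq_top_iff]
  set H := ((QuotientAddGroup.mk' (AddSubgroup.zmultiples g)).comp θ).range
  have hsucc : ∀ i : Fin n, QuotientAddGroup.mk' (AddSubgroup.zmultiples g) (s i.succ) ∈ H := by
    intro i
    refine ⟨Pi.single i 1, ?_⟩
    change QuotientAddGroup.mk' _ (∑ j, (Pi.single i 1 : Fin n → ℤ) j • s j.succ) = _
    rw [Finset.sum_eq_single i (fun j _ hj => by rw [Pi.single_eq_of_ne hj, zero_smul]) (by simp)]
    simp
  have hlast : QuotientAddGroup.mk' (AddSubgroup.zmultiples g) (s (Fin.last n)) ∈ H := by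
    obtain ⟨k, rfl⟩ := Nat.exists_eq_succ_of_ne_zero hn.ne'
    rw [← Fin.succ_last]
    exact hsucc _
  -- Modulo g = s_0 + c•s_n the generator s_0 equals -c•s_n, so s_1, …, s_n suffice.
  have hzero : QuotientAddGroup.mk' (AddSubgroup.zmultiples g) (s 0) ∈ H := by
    have hg : QuotientAddGroup.mk' (AddSubgroup.zmultiples g) g = 0 :=
      (QuotientAddGroup.eq_zero_iff g).mpr (AddSubgroup.mem_zmultiples g)
    rw [map_add, map_nsmul] at hg
    rw [eq_neg_of_add_eq_zero_left hg]
    exact neg_mem (nsmul_mem hlast c)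
  intro y _
  obtain ⟨x, rfl⟩ := QuotientAddGroup.mk'_surjective _ y
  rw [hx x, map_sum]
  refine sum_mem fun i _ => ?_
  rw [map_nsmul]
  refine nsmul_mem ?_ _
  induction i using Fin.cases with
  | zero => exact hzero
  | succ i => exact hsucc i

/-- Every abelian group of order `(2 * e + 1) ^ n` generated by `n` elements factorizes as a
sum of `n` arithmetic progressions `{-e • g, …, e • g}`. -/
theorem exists_box_injective (e : ℕ) : ∀ {n : ℕ} {d : Fin n → ℕ}, (∀ i, d i ≠ 0) →
    (∀ i j, i ≤ j → d i ∣ d j) → ∏ i, d i = (2 * e + 1) ^ n →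
    ∃ g : Fin n → ∀ i, ZMod (d i), ∀ a b : Fin n → ℤ, (∀ i, |a i| ≤ e) → (∀ i, |b i| ≤ e) →
      ∑ i, a i • g i = ∑ i, b i • g i → a = b
  | 0, _, _, _, _ => ⟨Fin.elim0, fun _ _ _ _ _ => Subsingleton.elim _ _⟩
  | n + 1, d, hd, hc, hprod => by
    obtain ⟨g₀, hg₀, ψ, hψ⟩ := exists_addOrderOf_eq_and_surjective hd hc hprod
    have : ∀ i, NeZero (d i) := fun i => ⟨hd i⟩
    obtain ⟨d', hd', hc', ⟨E⟩⟩ := exists_invariant_factors ψ hψ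
    have hord : addOrderOf g₀ = 2 * e + 1 :=
      Nat.dvd_antisymm (addOrderOf_dvd_of_nsmul_eq_zero ((hg₀ _).mpr dvd_rfl))
        ((hg₀ _).mp (addOrderOf_nsmul_eq_zero g₀))
    have hcard : ∏ i, d' i = (2 * e + 1) ^ n := by
      have h1 := Nat.card_congr E.toEquiv
      have h2 := AddSubgroup.card_mul_index (AddSubgroup.zmultiples g₀)
      rw [Nat.card_zmultiples, hord, AddSubgroup.index_eq_card, h1, Nat.card_pi, Nat.card_pi] at h2
      simp only [Nat.card_zmod] at h2
      rw [hprod, pow_succ'] at h2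
      exact Nat.eq_of_mul_eq_mul_left (by positivity) h2
    obtain ⟨g', hg'⟩ := exists_box_injective e hd' hc' hcard
    choose g hg using fun i => QuotientAddGroup.mk'_surjective (AddSubgroup.zmultiples g₀)
      (E.symm (g' i))
    refine ⟨Fin.cons g₀ g, fun a b ha hb hab => ?_⟩
    -- Modulo ⟨g₀⟩ the head term vanishes, so induction recovers the tail coefficients. The head
    -- coefficients then differ by a multiple of 2e+1 of absolute value at most 2e.
    have hproj : ∀ a : Fin (n + 1) → ℤ, E (QuotientAddGroup.mk' (AddSubgroup.zmultiples g₀)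
        (∑ i, a i • (Fin.cons g₀ g : Fin (n + 1) → ∀ i, ZMod (d i)) i))
          = ∑ i : Fin n, a i.succ • g' i := by
      intro a
      have h0 : QuotientAddGroup.mk' (AddSubgroup.zmultiples g₀) g₀ = 0 :=
        (QuotientAddGroup.eq_zero_iff g₀).mpr (AddSubgroup.mem_zmultiples g₀)
      simp only [Fin.sum_univ_succ, Fin.cons_zero, Fin.cons_succ, map_add, map_sum, map_zsmul, h0,
        hg, smul_zero, zero_add, AddEquiv.apply_symm_apply]
    have htail := hg' (fun i => a i.succ) (fun i => b i.succ) (fun i => ha _) (fun i => hb _)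
      (by rw [← hproj a, ← hproj b, hab])
    have htail' : ∀ i : Fin n, a i.succ = b i.succ := fun i => congrFun htail i
    have hhead : a 0 = b 0 := by
      simp only [Fin.sum_univ_succ, Fin.cons_zero, Fin.cons_succ, htail'] at hab
      have h := add_right_cancel hab
      rw [← sub_eq_zero, ← sub_smul, ← addOrderOf_dvd_iff_zsmul_eq_zero, hord] at h
      have h1 := abs_le.mp (ha 0)
      have h2 := abs_le.mp (hb 0)
      have h3 : a 0 - b 0 = 0 := by
        refine Int.eq_zero_of_abs_lt_dvd h ?_
        rw [abs_lt]
        push_cast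
        constructor <;> linarith
      linarith
    funext i
    induction i using Fin.cases with
    | zero => exact hhead
    | succ i => exact htail' i

/-! ### Perfect codes as kernels, and their classification by quotients. -/

namespace MaxMetricCode

theorem circDist_le_iff {q e : ℕ} (hq : 2 * e + 1 ≤ q) (x y : ZMod q) :
    circDist x y ≤ e ↔ ∃ a : ℤ, |a| ≤ e ∧ x = y + (a : ZMod q) := by
  have : NeZero q := ⟨by omega⟩
  have hx := ZMod.val_lt x
  have hy := ZMod.val_lt y
  have hcong : ∀ a : ℤ, x = y + (a : ZMod q) ↔ (q : ℤ) ∣ (x.val : ℤ) - y.val - a := by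
    intro a
    rw [← ZMod.intCast_zmod_eq_zero_iff_dvd]
    push_cast
    rw [ZMod.natCast_zmod_val, ZMod.natCast_zmod_val, sub_sub, sub_eq_zero]
  simp only [hcong, circDist]
  constructor
  · intro h
    rcases min_le_iff.mp h with h | h
    · exact ⟨(x.val : ℤ) - y.val, by rw [abs_le]; omega, by simp⟩
    · rcases le_total y.val x.val with hxy | hxy
      · exact ⟨(x.val : ℤ) - y.val - q, by rw [abs_le]; omega, by simp⟩
      · exact ⟨(x.val : ℤ) - y.val + q, by rw [abs_le]; omega, by simp⟩
  · rintro ⟨a, ha, k, hk⟩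
    rw [abs_le] at ha
    -- The representatives differ by less than q and |a| ≤ e < q, so only k ∈ {-1, 0, 1} survive.
    have hk1 : k < 2 := by
      by_contra! h
      nlinarith
    have hk2 : -2 < k := by
      by_contra! h
      nlinarith
    interval_cases k <;> omega

theorem mem_ball_iff {n q e : ℕ} (hq : 2 * e + 1 ≤ q) (x c : Fin n → ZMod q) :
    x ∈ ball c e ↔
      ∃ a : Fin n → ℤ, (∀ i, |a i| ≤ e) ∧ x = c + fun i => (a i : ZMod q) := by
  change Finset.univ.sup (fun i => circDist (x i) (c i)) ≤ e ↔ _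
  simp only [Finset.sup_le_iff, Finset.mem_univ, true_implies, circDist_le_iff hq, funext_iff,
    Pi.add_apply]
  constructor
  · intro h
    choose a ha using h
    exact ⟨a, fun i => (ha i).1, fun i => (ha i).2⟩
  · rintro ⟨a, ha, h⟩ i
    exact ⟨a i, ha i, h i⟩

theorem intCast_box_injective {n q e : ℕ} (hq : 2 * e + 1 ≤ q) {a b : Fin n → ℤ}
    (ha : ∀ i, |a i| ≤ e) (hb : ∀ i, |b i| ≤ e)
    (h : (fun i => (a i : ZMod q)) = fun i => (b i : ZMod q)) : a = b := by
  funext i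
  have h1 := abs_le.mp (ha i)
  have h2 := abs_le.mp (hb i)
  have hd := (ZMod.intCast_eq_intCast_iff_dvd_sub _ _ _).mp (congrFun h i)
  have := Int.eq_zero_of_abs_lt_dvd hd (by rw [abs_lt]; constructor <;> omega)
  linarith

theorem card_box (n e : ℕ) :
    Nat.card {a : Fin n → ℤ // ∀ i, |a i| ≤ e} = (2 * e + 1) ^ n := by
  have E : {a : Fin n → ℤ // ∀ i, |a i| ≤ e} ≃ (Fin n → Finset.Icc (-(e : ℤ)) e) :=
    (Equiv.subtypePiEquivPi (p := fun (_ : Fin n) (z : ℤ) => |z| ≤ e)).trans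
      (Equiv.piCongrRight fun _ => Equiv.subtypeEquivRight fun z => by
        rw [Finset.mem_Icc, abs_le])
  have hcard : (Finset.Icc (-(e : ℤ)) e).card = 2 * e + 1 := by
    rw [Int.card_Icc]
    omega
  rw [Nat.card_congr E, Nat.card_pi, Finset.prod_const, Finset.card_univ, Fintype.card_fin,
    Nat.card_eq_fintype_card, Fintype.card_coe, hcard]

/-- Reduction modulo `q` of integer vectors. -/
def redHom (n q : ℕ) : (Fin n → ℤ) →+ (Fin n → ZMod q) :=
  AddMonoidHom.pi fun i => (Int.castAddHom (ZMod q)).comp (Pi.evalAddMonoidHom _ i)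

theorem redHom_surjective (n q : ℕ) : Function.Surjective (redHom n q) := by
  intro y
  choose z hz using fun i => ZMod.intCast_surjective (y i)
  exact ⟨z, funext hz⟩

/-- The box is a transversal of C: if a and b lie in the same coset, b is in the balls around the
codewords 0 and b - a, so these coincide. -/
theorem IsPerfect.index_eq {n q e : ℕ} (hq : 2 * e + 1 ≤ q) {C : AddSubgroup (Fin n → ZMod q)}
    (hC : IsPerfect e (C : Set (Fin n → ZMod q))) : C.index = (2 * e + 1) ^ n := by
  rw [← card_box, AddSubgroup.index_eq_card]
  symm
  refine Nat.card_congr (Equiv.ofBijective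
    (fun a : {a : Fin n → ℤ // ∀ i, |a i| ≤ e} => (QuotientAddGroup.mk (redHom n q a.1) : _ ⧸ C))
    ⟨fun a b hab => ?_, fun y => ?_⟩)
  · have hmem := QuotientAddGroup.eq.mp hab
    obtain ⟨c, -, huniq⟩ := hC (redHom n q b.1)
    have h1 := huniq 0 ⟨C.zero_mem, (mem_ball_iff hq _ _).mpr ⟨b.1, b.2, (zero_add _).symm⟩⟩
    have h2 := huniq _ ⟨hmem, (mem_ball_iff hq _ _).mpr ⟨a.1, a.2, by
      change _ = -redHom n q a.1 + redHom n q b.1 + redHom n q a.1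
      abel⟩⟩
    refine Subtype.ext (intCast_box_injective hq a.2 b.2 ?_)
    change redHom n q a.1 = redHom n q b.1
    exact neg_add_eq_zero.mp (h2.trans h1.symm)
  · obtain ⟨x, rfl⟩ := QuotientAddGroup.mk_surjective y
    obtain ⟨c, ⟨hc, hx⟩, -⟩ := hC x
    obtain ⟨a, ha, rfl⟩ := (mem_ball_iff hq _ _).mp hx
    refine ⟨⟨a, ha⟩, QuotientAddGroup.eq.mpr ?_⟩
    change -redHom n q a + (c + redHom n q a) ∈ C
    rw [add_comm c, neg_add_cancel_left]
    exact hc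

/-- Injectivity on the box and equal cardinalities give a bijection from the box to G. The codeword
for x is x - a, where a is the unique box point with the same image as x. -/
theorem isPerfect_ker {n q e : ℕ} (hq : 2 * e + 1 ≤ q) {G : Type*} [AddCommGroup G] [Finite G]
    (ψ : (Fin n → ZMod q) →+ G) (hcard : Nat.card G = (2 * e + 1) ^ n)
    (hinj : ∀ a b : Fin n → ℤ, (∀ i, |a i| ≤ e) → (∀ i, |b i| ≤ e) →
      ψ (redHom n q a) = ψ (redHom n q b) → a = b) :
    IsPerfect e (ψ.ker : Set (Fin n → ZMod q)) ∧ Function.Surjective ψ := by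
  let F : {a : Fin n → ℤ // ∀ i, |a i| ≤ e} → G := fun a => ψ (redHom n q a.1)
  have hF : Function.Bijective F :=
    Function.Injective.bijective_of_nat_card_le
      (fun a b h => Subtype.ext (hinj a.1 b.1 a.2 b.2 h)) (by rw [card_box, hcard])
  refine ⟨fun x => ?_, fun y => ?_⟩
  · obtain ⟨a, ha⟩ := hF.2 (ψ x)
    refine ⟨x - redHom n q a.1, ⟨?_, (mem_ball_iff hq _ _).mpr ⟨a.1, a.2, ?_⟩⟩, ?_⟩
    · change ψ _ = 0
      rw [map_sub, sub_eq_zero]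
      exact ha.symm
    · exact (sub_add_cancel _ _).symm
    · rintro c ⟨hc, hx⟩
      obtain ⟨b, hb, rfl⟩ := (mem_ball_iff hq _ _).mp hx
      have hab : b = a.1 := by
        refine hinj b a.1 hb a.2 ?_
        change ψ (redHom n q a.1) = ψ (c + redHom n q b) at ha
        rw [ha, map_add, show ψ c = 0 from hc, zero_add]
      rw [← hab]
      exact (add_sub_cancel_right c (redHom n q b)).symm
  · obtain ⟨a, ha⟩ := hF.2 y
    exact ⟨_, ha⟩

/-- A unimodular transformation of `ℤⁿ` descends to an automorphism of `ℤ_qⁿ`. -/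
theorem exists_addEquiv_redHom {n : ℕ} (q : ℕ) (B : (Fin n → ℤ) ≃ₗ[ℤ] (Fin n → ℤ)) :
    ∃ f : (Fin n → ZMod q) ≃+ (Fin n → ZMod q), ∀ z, f (redHom n q z) = redHom n q (B z) := by
  let r := Int.castRingHom (ZMod q)
  have h1 : (LinearMap.toMatrix' B.toLinearMap) * (LinearMap.toMatrix' B.symm.toLinearMap) = 1 := by
    rw [← LinearMap.toMatrix'_comp]
    simp
  have h2 : (LinearMap.toMatrix' B.symm.toLinearMap) * (LinearMap.toMatrix' B.toLinearMap) = 1 := by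
    rw [← LinearMap.toMatrix'_comp]
    simp
  have h1' : (LinearMap.toMatrix' B.toLinearMap).map r *
      (LinearMap.toMatrix' B.symm.toLinearMap).map r = 1 := by
    rw [← Matrix.map_mul, h1, Matrix.map_one _ (map_zero r) (map_one r)]
  have h2' : (LinearMap.toMatrix' B.symm.toLinearMap).map r *
      (LinearMap.toMatrix' B.toLinearMap).map r = 1 := by
    rw [← Matrix.map_mul, h2, Matrix.map_one _ (map_zero r) (map_one r)]
  refine ⟨(Matrix.toLin'OfInv h2' h1').toAddEquiv, fun z => funext fun i => ?_⟩
  change ((LinearMap.toMatrix' B.toLinearMap).map r).mulVec (r ∘ z) i = r (B z i)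
  rw [← RingHom.map_mulVec, LinearMap.toMatrix'_mulVec]
  rfl

/-- Smith normal form of a subgroup of `ℤ_qⁿ`. -/
theorem exists_smith_of_addSubgroup {n q : ℕ} (hq : q ≠ 0) (C : AddSubgroup (Fin n → ZMod q)) :
    ∃ (A : (Fin n → ℤ) ≃ₗ[ℤ] (Fin n → ℤ)) (d : Fin n → ℕ), (∀ i, d i ≠ 0) ∧
      (∀ i j, i ≤ j → d i ∣ d j) ∧ (∀ z, redHom n q z ∈ C ↔ ∀ i, (d i : ℤ) ∣ A z i) ∧
      Nonempty ((Fin n → ZMod q) ⧸ C ≃+ ∀ i, ZMod (d i)) := by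
  obtain ⟨A, d, hc, hdN, hA⟩ := exists_smith_chain
    (AddSubgroup.toIntSubmodule (C.comap (redHom n q))) hq fun x => by
      change redHom n q _ ∈ C
      convert C.zero_mem
      funext i
      change (((q : ℤ) * x i : ℤ) : ZMod q) = 0
      simp
  have hA' : ∀ z, redHom n q z ∈ C ↔ ∀ i, (d i : ℤ) ∣ A z i := hA
  refine ⟨A, d, fun i hi => hq (by simpa [hi] using hdN i), hc, hA', ?_⟩
  refine nonempty_addEquiv_pi_zmod ((QuotientAddGroup.mk' C).comp (redHom n q))
    ((QuotientAddGroup.mk'_surjective C).comp (redHom_surjective n q)) A d fun x => ?_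
  rw [← hA']
  exact QuotientAddGroup.eq_zero_iff (N := C) (redHom n q x)

/-- Subgroups of `ℤ_qⁿ` are equivalent under automorphisms iff their quotients are isomorphic. -/
theorem exists_map_eq_iff_nonempty_quotient_addEquiv {n q : ℕ} (hq : q ≠ 0)
    (C₁ C₂ : AddSubgroup (Fin n → ZMod q)) :
    (∃ f : (Fin n → ZMod q) ≃+ (Fin n → ZMod q), C₁ = C₂.map f.toAddMonoidHom) ↔
      Nonempty ((Fin n → ZMod q) ⧸ C₁ ≃+ (Fin n → ZMod q) ⧸ C₂) := by
  constructor
  · rintro ⟨f, hf⟩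
    exact ⟨(QuotientAddGroup.congr C₂ C₁ f hf.symm).symm⟩
  · rintro ⟨E⟩
    obtain ⟨A₁, d₁, h₁, hc₁, hA₁, ⟨E₁⟩⟩ := exists_smith_of_addSubgroup hq C₁
    obtain ⟨A₂, d₂, h₂, hc₂, hA₂, ⟨E₂⟩⟩ := exists_smith_of_addSubgroup hq C₂
    have hd : d₁ = d₂ := invariant_factors_unique h₁ h₂ hc₁ hc₂ ((E₁.symm.trans E).trans E₂)
    subst hd
    -- `E` itself is not lifted, only the equality of invariant factors is used: A₁⁻¹A₂ carries the
    -- lattice of C₂ onto that of C₁.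
    obtain ⟨f, hf⟩ := exists_addEquiv_redHom q (A₂.trans A₁.symm)
    have hiff : ∀ x, f x ∈ C₁ ↔ x ∈ C₂ := by
      intro x
      obtain ⟨z, rfl⟩ := redHom_surjective n q x
      rw [hf, hA₁, hA₂]
      simp
    refine ⟨f, ?_⟩
    ext y
    obtain ⟨x, rfl⟩ := f.surjective y
    rw [hiff, AddSubgroup.mem_map]
    exact ⟨fun h => ⟨x, h, rfl⟩, fun ⟨x', h, hx'⟩ => f.injective hx' ▸ h⟩

/-- Every divisor chain with product `(2 * e + 1) ^ n` comes from a linear perfect code. -/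
theorem exists_isPerfect_quotient_addEquiv {n q e : ℕ} (hq : 2 * e + 1 ≤ q)
    (hdvd : (2 * e + 1) ^ n ∣ q) {d : Fin n → ℕ} (hc : ∀ i j, i ≤ j → d i ∣ d j)
    (hprod : ∏ i, d i = (2 * e + 1) ^ n) :
    ∃ C : AddSubgroup (Fin n → ZMod q), IsPerfect e (C : Set (Fin n → ZMod q)) ∧
      Nonempty ((Fin n → ZMod q) ⧸ C ≃+ ∀ i, ZMod (d i)) := by
  have hd : ∀ i, d i ≠ 0 := fun i hi => by
    have := Finset.prod_eq_zero (Finset.mem_univ i) hi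
    rw [hprod] at this
    exact pow_ne_zero n (by omega) this
  have : ∀ i, NeZero (d i) := fun i => ⟨hd i⟩
  obtain ⟨g, hg⟩ := exists_box_injective e hd hc hprod
  -- The divisibility hypothesis enters here: each d_i divides q, so any choice of the `g i` extends
  -- to a homomorphism on ℤ_q^n.
  have hkill : ∀ x : ∀ i, ZMod (d i), q • x = 0 := by
    intro x
    funext i
    have : d i ∣ q := (hprod ▸ Finset.dvd_prod_of_mem d (Finset.mem_univ i)).trans hdvd
    rw [Pi.smul_apply, nsmul_eq_mul, (ZMod.natCast_eq_zero_iff q (d i)).mpr this, zero_mul]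
    rfl
  have hlift : ∀ i, zmultiplesHom (∀ i, ZMod (d i)) (g i) q = 0 := fun i => by
    rw [zmultiplesHom_apply, natCast_zsmul, hkill]
  let l : Fin n → (ZMod q →+ ∀ i, ZMod (d i)) := fun i =>
    ZMod.lift q ⟨zmultiplesHom _ (g i), hlift i⟩
  let ψ : (Fin n → ZMod q) →+ ∀ i, ZMod (d i) :=
    ∑ i, (l i).comp (Pi.evalAddMonoidHom _ i)
  have hψ : ∀ a, ψ (redHom n q a) = ∑ i, a i • g i := by
    intro a
    rw [AddMonoidHom.finsetSum_apply]
    refine Finset.sum_congr rfl fun i _ => ?_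
    exact ZMod.lift_coe q (⟨zmultiplesHom _ (g i), hlift i⟩ :
      {f : ℤ →+ ∀ i, ZMod (d i) // f q = 0}) (a i)
  obtain ⟨hperf, hsurj⟩ := isPerfect_ker hq ψ
    (by rw [Nat.card_pi, ← hprod]; simp only [Nat.card_zmod])
    (fun a b ha hb h => hg a b ha hb (by rwa [hψ, hψ] at h))
  exact ⟨ψ.ker, hperf, ⟨QuotientAddGroup.quotientKerEquivOfSurjective ψ hsurj⟩⟩

theorem numIsoClasses_eq_card_chains {n q e : ℕ} (hq0 : q ≠ 0) (hq : 2 * e + 1 ≤ q)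
    (hdvd : (2 * e + 1) ^ n ∣ q) :
    numIsoClasses n e q = Nat.card {d : Fin n → ℕ // (∀ i j, i ≤ j → d i ∣ d j) ∧
      ∏ i, d i = (2 * e + 1) ^ n} := by
  choose C hC E using fun d : {d : Fin n → ℕ // (∀ i j, i ≤ j → d i ∣ d j) ∧
    ∏ i, d i = (2 * e + 1) ^ n} => exists_isPerfect_quotient_addEquiv hq hdvd d.2.1 d.2.2
  have hd0 : ∀ (d : {d : Fin n → ℕ // (∀ i j, i ≤ j → d i ∣ d j) ∧
      ∏ i, d i = (2 * e + 1) ^ n}) i, d.1 i ≠ 0 := fun d i hi => by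
    have := Finset.prod_eq_zero (Finset.mem_univ i) hi
    rw [d.2.2] at this
    exact pow_ne_zero n (by omega) this
  symm
  refine Nat.card_congr (Equiv.ofBijective
    (fun d => Quotient.mk (isoSetoid n e q) ⟨C d, hC d⟩) ⟨fun d d' h => ?_, fun y => ?_⟩)
  · have h' := Quotient.exact h
    obtain ⟨F⟩ := (exists_map_eq_iff_nonempty_quotient_addEquiv hq0 _ _).mp h'
    obtain ⟨E₁⟩ := E d
    obtain ⟨E₂⟩ := E d'
    exact Subtype.ext (invariant_factors_unique (hd0 d) (hd0 d') d.2.1 d'.2.1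
      ((E₁.symm.trans F).trans E₂))
  · induction y using Quotient.inductionOn with
    | h D =>
      obtain ⟨-, d, hd, hc, -, ⟨F⟩⟩ := exists_smith_of_addSubgroup hq0 D.1
      have hprod : ∏ i, d i = (2 * e + 1) ^ n := by
        rw [← D.2.index_eq hq, AddSubgroup.index_eq_card, Nat.card_congr F.toEquiv, Nat.card_pi]
        simp only [Nat.card_zmod]
      obtain ⟨E'⟩ := E ⟨d, hc, hprod⟩
      refine ⟨⟨d, hc, hprod⟩, Quotient.sound ?_⟩
      exact (exists_map_eq_iff_nonempty_quotient_addEquiv hq0 _ _).mpr ⟨E'.trans F.symm⟩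

end MaxMetricCode

/-! ### Counting divisor chains by partitions. -/

namespace MaxMetricCode

/-- Monotone `n`-tuples of natural numbers with sum `N`, i.e. partitions of `N` into at most
`n` parts. -/
def monoTuples (n N : ℕ) : Set (Fin n → ℕ) := {l | Monotone l ∧ ∑ i, l i = N}

theorem monoTuples_finite (n N : ℕ) : (monoTuples n N).Finite := by
  refine (Set.finite_Iic (fun _ : Fin n => N)).subset fun l hl i => ?_
  rw [← hl.2]
  exact Finset.single_le_sum (f := l) (fun _ _ => Nat.zero_le _) (Finset.mem_univ i)

theorem ncard_monoTuples_zero (N : ℕ) : (monoTuples 0 N).ncard = if N = 0 then 1 else 0 := by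
  split_ifs with h
  · rw [Set.ncard_eq_one]
    refine ⟨Fin.elim0, Set.eq_singleton_iff_unique_mem.mpr ⟨⟨fun i => i.elim0, ?_⟩,
      fun _ _ => Subsingleton.elim _ _⟩⟩
    simp [h]
  · rw [Set.ncard_eq_zero (monoTuples_finite 0 N), Set.eq_empty_iff_forall_notMem]
    rintro l ⟨-, hl⟩
    exact h (by simpa using hl.symm)

theorem ncard_monoTuples_head_eq_zero (n N : ℕ) :
    {l ∈ monoTuples (n + 1) N | l 0 = 0}.ncard = (monoTuples n N).ncard := by
  have h : {l ∈ monoTuples (n + 1) N | l 0 = 0}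
      = (fun l : Fin n → ℕ => (Fin.cons 0 l : Fin (n + 1) → ℕ)) '' monoTuples n N := by
    ext l
    constructor
    · rintro ⟨⟨hm, hs⟩, h0⟩
      refine ⟨Fin.tail l, ⟨fun i j hij => hm (Fin.succ_le_succ_iff.mpr hij), ?_⟩, ?_⟩
      · rw [Fin.sum_univ_succ, h0, zero_add] at hs
        exact hs
      · change (Fin.cons 0 (Fin.tail l) : Fin (n + 1) → ℕ) = l
        rw [← h0, Fin.cons_self_tail]
    · rintro ⟨l, ⟨hm, hs⟩, rfl⟩
      refine ⟨⟨fun i j hij => ?_, by simpa [Fin.sum_univ_succ] using hs⟩, Fin.cons_zero _ _⟩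
      induction i using Fin.cases with
      | zero => simp
      | succ i =>
        induction j using Fin.cases with
        | zero => exact absurd hij (by simp)
        | succ j => simpa using hm (Fin.succ_le_succ_iff.mp hij)
  rw [h, Set.ncard_image_of_injective]
  exact Fin.cons_right_injective (α := fun _ => ℕ) 0

theorem ncard_monoTuples_head_ne_zero (n N : ℕ) :
    {l ∈ monoTuples (n + 1) (N + (n + 1)) | l 0 ≠ 0}.ncard = (monoTuples (n + 1) N).ncard := by
  have h : {l ∈ monoTuples (n + 1) (N + (n + 1)) | l 0 ≠ 0}
      = (fun (l : Fin (n + 1) → ℕ) i => l i + 1) '' monoTuples (n + 1) N := by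
    ext l
    constructor
    · rintro ⟨⟨hm, hs⟩, h0⟩
      have hpos : ∀ i, 1 ≤ l i := fun i => (Nat.one_le_iff_ne_zero.mpr h0).trans (hm (Fin.zero_le i))
      have hl : (fun i => (l i - 1) + 1) = l := funext fun i => Nat.sub_add_cancel (hpos i)
      refine ⟨fun i => l i - 1, ⟨fun i j hij => Nat.sub_le_sub_right (hm hij) 1, ?_⟩, hl⟩
      rw [← hl, Finset.sum_add_distrib] at hs
      simpa using hs
    · rintro ⟨l, ⟨hm, hs⟩, rfl⟩
      exact ⟨⟨fun i j hij => Nat.add_le_add_right (hm hij) 1,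
        by simp [Finset.sum_add_distrib, hs]⟩, Nat.succ_ne_zero _⟩
  rw [h, Set.ncard_image_of_injective]
  intro a b hab
  funext i
  exact Nat.add_right_cancel (congrFun hab i)

/-- The head is the smallest part: a zero head is dropped, and otherwise 1 can be subtracted from
every part. -/
theorem ncard_monoTuples_split (n N : ℕ) : (monoTuples (n + 1) N).ncard
    = (monoTuples n N).ncard + {l ∈ monoTuples (n + 1) N | l 0 ≠ 0}.ncard := by
  rw [← ncard_monoTuples_head_eq_zero n N, ← Set.ncard_union_eq ?_
    ((monoTuples_finite _ _).subset fun l hl => hl.1)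
    ((monoTuples_finite _ _).subset fun l hl => hl.1)]
  · congr 1
    ext l
    simp only [Set.mem_union, Set.mem_ofPred_eq]
    tauto
  · rw [Set.disjoint_left]
    exact fun l h h' => h'.2 h.2

theorem ncard_monoTuples_succ_add (n N : ℕ) : (monoTuples (n + 1) (N + (n + 1))).ncard
    = (monoTuples n (N + (n + 1))).ncard + (monoTuples (n + 1) N).ncard := by
  rw [ncard_monoTuples_split, ncard_monoTuples_head_ne_zero]

theorem ncard_monoTuples_succ_of_lt {n N : ℕ} (h : N < n + 1) :
    (monoTuples (n + 1) N).ncard = (monoTuples n N).ncard := by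
  rw [ncard_monoTuples_split, Nat.add_eq_left,
    Set.ncard_eq_zero ((monoTuples_finite _ _).subset fun l hl => hl.1),
    Set.eq_empty_iff_forall_notMem]
  rintro l ⟨⟨hm, hs⟩, h0⟩
  have : ∑ _i : Fin (n + 1), 1 ≤ ∑ i, l i :=
    Finset.sum_le_sum fun i _ => (Nat.one_le_iff_ne_zero.mpr h0).trans (hm (Fin.zero_le i))
  rw [hs] at this
  simp at this
  omega

/-- By the recurrence, multiplication by 1 - X^(n+1) takes the counting series for n+1 to the one
for n, and the series for n = 0 is 1. -/
theorem genFun_eq_mk (n : ℕ) :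
    genFun n = PowerSeries.mk fun N => ((monoTuples n N).ncard : ℚ) := by
  have hstep : ∀ n, (PowerSeries.mk fun N => ((monoTuples (n + 1) N).ncard : ℚ))
      * (1 - PowerSeries.X ^ (n + 1)) = PowerSeries.mk fun N => ((monoTuples n N).ncard : ℚ) := by
    intro n
    ext N
    rw [mul_sub, mul_one, map_sub, PowerSeries.coeff_mul_X_pow', PowerSeries.coeff_mk]
    split_ifs with h
    · obtain ⟨M, rfl⟩ := Nat.exists_eq_add_of_le' h
      rw [Nat.add_sub_cancel, PowerSeries.coeff_mk, PowerSeries.coeff_mk, ncard_monoTuples_succ_add]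
      push_cast
      ring
    · rw [ncard_monoTuples_succ_of_lt (not_le.mp h), sub_zero, PowerSeries.coeff_mk]
  have hprod : ∀ n, (PowerSeries.mk fun N => ((monoTuples n N).ncard : ℚ))
      * ∏ i ∈ Finset.Icc 1 n, (1 - (PowerSeries.X : PowerSeries ℚ) ^ i) = 1 := by
    intro n
    induction n with
    | zero =>
      ext N
      simp [ncard_monoTuples_zero, PowerSeries.coeff_one]
    | succ n ih =>
      rw [Finset.prod_Icc_succ_top (by omega), mul_comm (∏ i ∈ _, _), ← mul_assoc, hstep, ih]
  rw [genFun, eq_comm, PowerSeries.eq_inv_iff_mul_eq_one]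
  · exact hprod n
  · rw [map_prod, Finset.prod_ne_zero_iff]
    intro i hi
    have : i ≠ 0 := by
      have := (Finset.mem_Icc.mp hi).1
      omega
    simp [this]

theorem ncard_monoTuples_one (N : ℕ) : (monoTuples 1 N).ncard = 1 := by
  induction N with
  | zero => rw [ncard_monoTuples_succ_of_lt (by omega), ncard_monoTuples_zero, if_pos rfl]
  | succ N ih =>
    rw [ncard_monoTuples_succ_add 0 N, ncard_monoTuples_zero, if_neg (by omega), ih]

theorem ncard_monoTuples_two (N : ℕ) : (monoTuples 2 N).ncard = N / 2 + 1 := by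
  induction N using Nat.strong_induction_on with
  | _ N ih =>
    rcases Nat.lt_or_ge N 2 with h | h
    · rw [ncard_monoTuples_succ_of_lt h, ncard_monoTuples_one]
      omega
    · obtain ⟨M, rfl⟩ := Nat.exists_eq_add_of_le' h
      rw [ncard_monoTuples_succ_add 1 M, ncard_monoTuples_one, ih M (by omega)]
      omega

/-- Passing from 3v to 3(v+1) adds ⌊3(v+1)/2⌋ + 1, which depends on the parity of v; hence two
closed forms proved together. -/
theorem ncard_monoTuples_three (k : ℕ) :
    (monoTuples 3 (3 * (2 * k))).ncard = 3 * k ^ 2 + 3 * k + 1 ∧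
      (monoTuples 3 (3 * (2 * k + 1))).ncard = 3 * (k + 1) ^ 2 := by
  have hodd : ∀ k, (monoTuples 3 (3 * (2 * k + 1))).ncard
      = 3 * k + 2 + (monoTuples 3 (3 * (2 * k))).ncard := by
    intro k
    rw [show 3 * (2 * k + 1) = 3 * (2 * k) + (2 + 1) by ring, ncard_monoTuples_succ_add,
      ncard_monoTuples_two]
    have : (3 * (2 * k) + (2 + 1)) / 2 + 1 = 3 * k + 2 := by omega
    rw [this]
  induction k with
  | zero =>
    have h0 : (monoTuples 3 (3 * (2 * 0))).ncard = 1 := by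
      rw [ncard_monoTuples_succ_of_lt (by omega), ncard_monoTuples_two]
    exact ⟨h0, by rw [hodd, h0]; norm_num⟩
  | succ k ih =>
    have heven : (monoTuples 3 (3 * (2 * (k + 1)))).ncard = 3 * (k + 1) ^ 2 + 3 * (k + 1) + 1 := by
      rw [show 3 * (2 * (k + 1)) = 3 * (2 * k + 1) + (2 + 1) by ring, ncard_monoTuples_succ_add,
        ncard_monoTuples_two, ih.2]
      have : (3 * (2 * k + 1) + (2 + 1)) / 2 = 3 * k + 3 := by omega
      rw [this]
      ring
    exact ⟨heven, by rw [hodd, heven]; ring⟩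

/-- For v = 2k the rounded number is 3k² + 3k + 3/4, a quarter below the count; for v = 2k+1 it
equals the count. -/
theorem ncard_monoTuples_three_eq_round (v : ℕ) :
    ((monoTuples 3 (3 * v)).ncard : ℤ) = round ((3 / 4 : ℚ) * ((v : ℚ) + 1) ^ 2) := by
  rw [round_eq, eq_comm, Int.floor_eq_iff]
  obtain ⟨k, rfl | rfl⟩ := Nat.even_or_odd' v
  · rw [(ncard_monoTuples_three k).1]
    push_cast
    constructor <;> linarith
  · rw [(ncard_monoTuples_three k).2]
    push_cast
    constructor <;> linarith

/-- Exponents are independent across primes: divisibility becomes monotonicity at each p, and the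
product condition becomes a sum n·ν_p(m). -/
theorem card_chains_eq_prod {n m : ℕ} (hm : m ≠ 0) :
    Nat.card {d : Fin n → ℕ // (∀ i j, i ≤ j → d i ∣ d j) ∧ ∏ i, d i = m ^ n}
      = ∏ p ∈ m.primeFactors, (monoTuples n (n * m.factorization p)).ncard := by
  have hd0 : ∀ d : Fin n → ℕ, ∏ i, d i = m ^ n → ∀ i, d i ≠ 0 := fun d hd i hi => by
    have := Finset.prod_eq_zero (Finset.mem_univ i) hi
    rw [hd] at this
    exact pow_ne_zero n hm this
  let F : {d : Fin n → ℕ // (∀ i j, i ≤ j → d i ∣ d j) ∧ ∏ i, d i = m ^ n} →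
      ∀ p : m.primeFactors, monoTuples n (n * m.factorization p) := fun d p =>
    ⟨fun i => (d.1 i).factorization p,
      factorization_mono_of_chain (hd0 d.1 d.2.2) d.2.1 p, by
        rw [← Finsupp.finsetSum_apply, ← Nat.factorization_prod fun i _ => hd0 d.1 d.2.2 i, d.2.2,
          Nat.factorization_pow, Finsupp.smul_apply, smul_eq_mul]⟩
  have hF : Function.Bijective F := by
    constructor
    · intro d d' h
      -- Each d_i divides m^n, so no prime outside m occurs.
      have hout : ∀ d : Fin n → ℕ, ∏ i, d i = m ^ n → ∀ i p, p ∉ m.primeFactors →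
          (d i).factorization p = 0 := by
        intro d hd i p hp
        have hle := (Nat.factorization_le_iff_dvd (hd0 d hd i) (pow_ne_zero n hm)).mpr
          (hd ▸ Finset.dvd_prod_of_mem d (Finset.mem_univ i)) p
        have h0 : m.factorization p = 0 := Finsupp.notMem_support_iff.mp hp
        rw [Nat.factorization_pow, Finsupp.smul_apply, h0, smul_zero] at hle
        exact Nat.le_zero.mp hle
      refine Subtype.ext (funext fun i => Nat.eq_of_factorization_eq (hd0 _ d.2.2 i)
        (hd0 _ d'.2.2 i) fun p => ?_)
      by_cases hp : p ∈ m.primeFactors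
      · exact congrFun (congrArg Subtype.val (congrFun h ⟨p, hp⟩)) i
      · rw [hout _ d.2.2 i p hp, hout _ d'.2.2 i p hp]
    · intro l
      have hpow : ∀ p : m.primeFactors, (p : ℕ) ≠ 0 := fun p =>
        (Nat.prime_of_mem_primeFactors p.2).ne_zero
      refine ⟨⟨fun i => ∏ p : m.primeFactors, (p : ℕ) ^ (l p).1 i, fun i j hij => ?_, ?_⟩, ?_⟩
      · exact Finset.prod_dvd_prod_of_dvd _ _ fun p _ => pow_dvd_pow _ ((l p).2.1 hij)
      · rw [Finset.prod_comm]
        simp_rw [Finset.prod_pow_eq_pow_sum]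
        have : ∀ p : m.primeFactors, (p : ℕ) ^ (∑ i, (l p).1 i)
            = ((p : ℕ) ^ m.factorization p) ^ n := fun p => by
          rw [(l p).2.2, mul_comm, pow_mul]
        simp_rw [this]
        rw [Finset.prod_pow, Finset.prod_coe_sort m.primeFactors fun p => p ^ m.factorization p]
        congr 1
        exact Nat.prod_factorization_pow_eq_self hm
      · funext p
        refine Subtype.ext (funext fun i => ?_)
        change (∏ p : m.primeFactors, (p : ℕ) ^ (l p).1 i).factorization p = (l p).1 i
        rw [Nat.factorization_prod fun p _ => pow_ne_zero _ (hpow p), Finsupp.finsetSum_apply,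
          Finset.sum_eq_single p]
        · rw [(Nat.prime_of_mem_primeFactors p.2).factorization_pow, Finsupp.single_eq_same]
        · intro p' _ hne
          rw [(Nat.prime_of_mem_primeFactors p'.2).factorization_pow, Finsupp.single_eq_of_ne]
          exact fun h => hne (Subtype.ext h.symm)
        · simp
  rw [Nat.card_congr (Equiv.ofBijective F hF), Nat.card_pi]
  simp only [Nat.card_coe_set_eq]
  exact Finset.prod_coe_sort m.primeFactors
    fun p => (monoTuples n (n * m.factorization p)).ncard

theorem numIsoClasses_eq_prod {n e q : ℕ} (hq0 : q ≠ 0) (hq : 2 * e + 1 ≤ q)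
    (hdvd : (2 * e + 1) ^ n ∣ q) :
    numIsoClasses n e q = ∏ p ∈ (2 * e + 1).primeFactors,
      (monoTuples n (n * padicValNat p (2 * e + 1))).ncard := by
  rw [numIsoClasses_eq_card_chains hq0 hq hdvd, card_chains_eq_prod (by omega)]
  refine Finset.prod_congr rfl fun p hp => ?_
  rw [Nat.factorization_def _ (Nat.prime_of_mem_primeFactors hp)]

end MaxMetricCode

/-! ### The main theorem and the cases n = 2, 3. -/

theorem mainTheorem9 (n e t q : ℕ) (hn : 1 ≤ n) (he : 1 ≤ e) (ht : 1 ≤ t)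
    (hq : q = (2 * e + 1) * t) (hdvd : (2 * e + 1) ^ (n - 1) ∣ t) :
    ((MaxMetricCode.numIsoClasses n e q : ℚ) =
      ∏ p ∈ (2 * e + 1).primeFactors,
        PowerSeries.coeff (n * padicValNat p (2 * e + 1)) (MaxMetricCode.genFun n)) ∧
    (n = 2 →
      (MaxMetricCode.numIsoClasses n e q : ℚ) =
        ∏ p ∈ (2 * e + 1).primeFactors,
          PowerSeries.coeff (2 * padicValNat p (2 * e + 1)) (MaxMetricCode.genFun 2) ∧
      MaxMetricCode.numIsoClasses n e q =
        ∏ p ∈ (2 * e + 1).primeFactors, (padicValNat p (2 * e + 1) + 1) ∧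
      MaxMetricCode.numIsoClasses n e q = ArithmeticFunction.sigma 0 (2 * e + 1)) ∧
    (n = 3 →
      (MaxMetricCode.numIsoClasses n e q : ℚ) =
        ∏ p ∈ (2 * e + 1).primeFactors,
          PowerSeries.coeff (3 * padicValNat p (2 * e + 1)) (MaxMetricCode.genFun 3) ∧
      (MaxMetricCode.numIsoClasses n e q : ℤ) =
        ∏ p ∈ (2 * e + 1).primeFactors,
          round ((3 / 4 : ℚ) * ((padicValNat p (2 * e + 1) : ℚ) + 1) ^ 2) ∧
      (Squarefree (2 * e + 1) →
        MaxMetricCode.numIsoClasses n e q =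
          3 ^ ArithmeticFunction.cardDistinctFactors (2 * e + 1))) := by
  have hq0 : q ≠ 0 := by rw [hq]; positivity
  have hqe : 2 * e + 1 ≤ q := by rw [hq]; exact Nat.le_mul_of_pos_right _ ht
  have hpow : (2 * e + 1) ^ n ∣ q := by
    obtain ⟨k, rfl⟩ := Nat.exists_eq_add_of_le' hn
    rw [hq, pow_succ']
    exact Nat.mul_dvd_mul_left _ hdvd
  have hN := MaxMetricCode.numIsoClasses_eq_prod hq0 hqe hpow
  have hcoeff : (MaxMetricCode.numIsoClasses n e q : ℚ) =
      ∏ p ∈ (2 * e + 1).primeFactors,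
        PowerSeries.coeff (n * padicValNat p (2 * e + 1)) (MaxMetricCode.genFun n) := by
    rw [hN, MaxMetricCode.genFun_eq_mk]
    push_cast
    simp only [PowerSeries.coeff_mk]
  refine ⟨hcoeff, ?_, ?_⟩
  · rintro rfl
    have h2 : MaxMetricCode.numIsoClasses 2 e q =
        ∏ p ∈ (2 * e + 1).primeFactors, (padicValNat p (2 * e + 1) + 1) := by
      rw [hN]
      refine Finset.prod_congr rfl fun p _ => ?_
      rw [MaxMetricCode.ncard_monoTuples_two, Nat.mul_div_cancel_left _ (by norm_num)]
    refine ⟨hcoeff, h2, ?_⟩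
    rw [h2, ArithmeticFunction.sigma_zero_apply, Nat.card_divisors (by omega)]
    refine Finset.prod_congr rfl fun p hp => ?_
    rw [Nat.factorization_def _ (Nat.prime_of_mem_primeFactors hp)]
  · rintro rfl
    refine ⟨hcoeff, ?_, fun hsq => ?_⟩
    · rw [hN]
      push_cast
      exact Finset.prod_congr rfl fun p _ => MaxMetricCode.ncard_monoTuples_three_eq_round _
    · rw [hN, ArithmeticFunction.cardDistinctFactors_apply, ← List.card_toFinset]
      change _ = 3 ^ (2 * e + 1).primeFactors.card
      rw [← Finset.prod_const]
      refine Finset.prod_congr rfl fun p hp => ?_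
      have hpp := Nat.prime_of_mem_primeFactors hp
      rw [← Nat.factorization_def _ hpp, 
        Nat.factorization_eq_one_of_squarefree hsq hpp (Nat.dvd_of_mem_primeFactors hp)]
      -- Exponent 1 is the odd case with k = 0, giving 3·1² = 3.
      simpa using (MaxMetricCode.ncard_monoTuples_three 0).2
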